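/- Let $G$ be any group. Put $\mathrm{Cyc}(G)=\{y\in G : \langle x,y\rangle \text{ is cyclic for all } x\in G\}$, which is a normal subgroup of $G$, and let $\Gamma_G$ (the non-cyclic graph of $G$) be the simple graph with vertex set $G\setminus \mathrm{Cyc}(G)$ in which two vertices $x,y$ are adjacent if and only if the subgroup $\langle x,y\rangle$ is not cyclic. A clique is a set of pairwise adjacent vertices. Then $\Gamma_G$ has no infinite clique if and only if $G/\mathrm{Cyc}(G)$ is finite. In that case the clique number $\omega(\Gamma_G)$, i.e. the maximum size of a clique of $\Gamma_G$, exists and is finite, and $\omega(\Gamma_G)\le |G:\mathrm{Cyc}(G)|$. (If $G$ is locally cyclic, $\Gamma_G$ is the empty graph and $\omega(\Gamma_G)=0$.) -/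

import Mathlib

namespace NonCyclicGraph

/-- The subgroup `⟨x, y⟩` is cyclic. -/
def GenCyclic {G : Type*} [Group G] (x y : G) : Prop :=
  IsCyclic (Subgroup.closure ({x, y} : Set G))

theorem genCyclic_iff {G : Type*} [Group G] (x y : G) :
    GenCyclic x y ↔ ∃ c : G, Subgroup.closure ({x, y} : Set G) = Subgroup.zpowers c := by
  unfold GenCyclic
  rw [Subgroup.isCyclic_iff_exists_zpowers_eq_top]
  exact ⟨fun ⟨c, h⟩ => ⟨c, h.symm⟩, fun ⟨c, h⟩ => ⟨c, h.symm⟩⟩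

theorem genCyclic_of_mem {G : Type*} [Group G] {x y d : G}
    (hx : x ∈ Subgroup.zpowers d) (hy : y ∈ Subgroup.zpowers d) : GenCyclic x y := by
  have h : Subgroup.closure ({x, y} : Set G) ≤ Subgroup.zpowers d := by
    rw [Subgroup.closure_le]
    rintro z (rfl | rfl)
    · exact hx
    · exact hy
  exact isCyclic_of_injective (Subgroup.inclusion h) (Subgroup.inclusion_injective h)

theorem GenCyclic.exists_mem {G : Type*} [Group G] {x y : G} (h : GenCyclic x y) :
    ∃ d : G, x ∈ Subgroup.zpowers d ∧ y ∈ Subgroup.zpowers d := by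
  obtain ⟨c, hc⟩ := (genCyclic_iff x y).1 h
  exact ⟨c, hc ▸ Subgroup.subset_closure (by simp), hc ▸ Subgroup.subset_closure (by simp)⟩

theorem genCyclic_self {G : Type*} [Group G] (x : G) : GenCyclic x x :=
  genCyclic_of_mem (Subgroup.mem_zpowers x) (Subgroup.mem_zpowers x)

theorem GenCyclic.symm {G : Type*} [Group G] {x y : G} (h : GenCyclic x y) : GenCyclic y x := by
  obtain ⟨d, hx, hy⟩ := h.exists_mem
  exact genCyclic_of_mem hy hx

/-- The cyclicizer `Cyc(G) = {y | ⟨x, y⟩ is cyclic for all x}`, a subgroup of `G`. -/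
def Cyc (G : Type*) [Group G] : Subgroup G where
  carrier := {y | ∀ x : G, GenCyclic x y}
  one_mem' := fun x => genCyclic_of_mem (Subgroup.mem_zpowers x) (Subgroup.one_mem _)
  mul_mem' := by
    intro a b ha hb x
    obtain ⟨c, hx, hac⟩ := (ha x).exists_mem
    obtain ⟨d, hcd, hbd⟩ := (hb c).exists_mem
    have hle : Subgroup.zpowers c ≤ Subgroup.zpowers d := Subgroup.zpowers_le.2 hcd
    exact genCyclic_of_mem (hle hx) (Subgroup.mul_mem _ (hle hac) hbd)
  inv_mem' := by
    intro a ha x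
    obtain ⟨c, hx, hac⟩ := (ha x).exists_mem
    exact genCyclic_of_mem hx (Subgroup.inv_mem _ hac)

theorem mem_Cyc {G : Type*} [Group G] {y : G} : y ∈ Cyc G ↔ ∀ x : G, GenCyclic x y :=
  Iff.rfl

/-- `Cyc(G)` is normal (it is even central), so `G ⧸ Cyc G` is a group. -/
instance Cyc_normal (G : Type*) [Group G] : (Cyc G).Normal where
  conj_mem := by
    intro y hy g
    obtain ⟨c, ⟨m, hm⟩, ⟨n, hn⟩⟩ := (hy g).exists_mem
    have hcomm : g * y = y * g := by
      rw [← hm, ← hn]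
      exact (Commute.zpow_zpow_self c m n).eq
    rwa [hcomm, mul_inv_cancel_right]

/-- The non-cyclic graph `Γ_G`: its vertices are the elements of `G` outside `Cyc(G)`, and two
vertices are adjacent when they do not generate a cyclic subgroup. -/
def nonCyclicGraph (G : Type*) [Group G] : SimpleGraph {x : G // x ∉ Cyc G} where
  Adj x y := ¬ GenCyclic (x : G) (y : G)
  symm := ⟨fun _ _ h h' => h h'.symm⟩
  loopless := ⟨fun x h => h (genCyclic_self (x : G))⟩

end NonCyclicGraph

namespace NonCyclicGraph

/-- Every infinite set contains two distinct elements generating a cyclic subgroup. -/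
def NoInfiniteNonCyclicSet (G : Type*) [Group G] : Prop :=
  ∀ s : Set G, s.Infinite → ∃ x ∈ s, ∃ y ∈ s, x ≠ y ∧ GenCyclic x y

theorem GenCyclic.exists_mem_closure {G : Type*} [Group G] {x y : G} (h : GenCyclic x y) :
    ∃ d ∈ Subgroup.closure ({x, y} : Set G),
      x ∈ Subgroup.zpowers d ∧ y ∈ Subgroup.zpowers d := by
  obtain ⟨c, hc⟩ := (genCyclic_iff x y).1 h
  exact ⟨c, hc ▸ Subgroup.mem_zpowers c, hc ▸ Subgroup.subset_closure (by simp),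
    hc ▸ Subgroup.subset_closure (by simp)⟩

theorem GenCyclic.commute {G : Type*} [Group G] {x y : G} (h : GenCyclic x y) :
    Commute x y := by
  obtain ⟨d, ⟨m, rfl⟩, ⟨n, rfl⟩⟩ := h.exists_mem
  exact Commute.zpow_zpow_self d m n

theorem genCyclic_coe {G : Type*} [Group G] {H : Subgroup G} {x y : H} :
    GenCyclic (x : G) (y : G) ↔ GenCyclic x y := by
  constructor
  · intro h
    obtain ⟨d, hd, ⟨m, hm⟩, ⟨n, hn⟩⟩ := h.exists_mem_closure
    have hdH : d ∈ H := (Subgroup.closure_le H).2 (by rintro z (rfl | rfl) <;> simp) hd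
    exact genCyclic_of_mem (d := ⟨d, hdH⟩) ⟨m, Subtype.ext hm⟩ ⟨n, Subtype.ext hn⟩
  · intro h
    obtain ⟨d, ⟨m, rfl⟩, ⟨n, rfl⟩⟩ := h.exists_mem
    exact genCyclic_of_mem (d := (d : G)) ⟨m, by simp⟩ ⟨n, by simp⟩

theorem NoInfiniteNonCyclicSet.subgroup {G : Type*} [Group G] (h : NoInfiniteNonCyclicSet G)
    (H : Subgroup G) : NoInfiniteNonCyclicSet H := by
  intro s hs
  obtain ⟨_, ⟨x, hx, rfl⟩, _, ⟨y, hy, rfl⟩, hne, hxy⟩ :=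
    h (Subtype.val '' s) (hs.image Subtype.val_injective.injOn)
  exact ⟨x, hx, y, hy, fun h => hne (congrArg _ h), genCyclic_coe.1 hxy⟩

theorem NoInfiniteNonCyclicSet.exists_lt {G : Type*} [Group G] (h : NoInfiniteNonCyclicSet G)
    (f : ℕ → G) : ∃ i j, i < j ∧ GenCyclic (f i) (f j) := by
  by_cases hf : Function.Injective f
  · obtain ⟨_, ⟨i, rfl⟩, _, ⟨j, rfl⟩, hne, hij⟩ := h _ (Set.infinite_range_of_injective hf)
    rcases lt_or_gt_of_ne (fun e : i = j => hne (congrArg f e)) with hlt | hlt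
    · exact ⟨i, j, hlt, hij⟩
    · exact ⟨j, i, hlt, hij.symm⟩
  · simp only [Function.Injective, not_forall] at hf
    obtain ⟨i, j, hij, hne⟩ := hf
    rcases lt_or_gt_of_ne hne with hlt | hlt
    · exact ⟨i, j, hlt, hij ▸ genCyclic_self _⟩
    · exact ⟨j, i, hlt, hij ▸ genCyclic_self _⟩

/-- If every infinite set contains two distinct related elements, then any pairwise unrelated
subset of `T` extends to a finite one in `T`, to which every element of `T` is related. -/
theorem exists_finite_maximal_pairwise {α : Type*} {r : α → α → Prop} (hrefl : ∀ x, r x x)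
    (hsymm : ∀ x y, r x y → r y x)
    (h : ∀ s : Set α, s.Infinite → ∃ x ∈ s, ∃ y ∈ s, x ≠ y ∧ r x y) {T s : Set α} (hsT : s ⊆ T)
    (hs : s.Pairwise fun x y => ¬ r x y) :
    ∃ M : Set α, s ⊆ M ∧ M ⊆ T ∧ M.Finite ∧ (M.Pairwise fun x y => ¬ r x y) ∧
      ∀ t ∈ T, ∃ m ∈ M, r t m := by
  obtain ⟨M, hsM, hM⟩ := zorn_subset_nonempty {M : Set α | M ⊆ T ∧ M.Pairwise fun x y => ¬ r x y}
    (fun c hc hchain _ => ⟨⋃₀ c, ⟨Set.sUnion_subset fun m hm => (hc hm).1,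
      (Set.pairwise_sUnion hchain.directedOn).2 fun m hm => (hc hm).2⟩,
      fun m hm => Set.subset_sUnion_of_mem hm⟩) s ⟨hsT, hs⟩
  refine ⟨M, hsM, hM.prop.1, ?_, hM.prop.2, ?_⟩
  · by_contra hinf
    obtain ⟨x, hx, y, hy, hne, hxy⟩ := h M hinf
    exact hM.prop.2 hx hy hne hxy
  · intro t ht
    by_contra! hcon
    have hins : insert t M ∈ {M : Set α | M ⊆ T ∧ M.Pairwise fun x y => ¬ r x y} :=
      ⟨Set.insert_subset ht hM.prop.1, hM.prop.2.insert fun m hm _ =>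
        ⟨hcon m hm, fun h' => hcon m hm (hsymm _ _ h')⟩⟩
    exact hcon t (hM.le_of_ge hins (Set.subset_insert t M) (Set.mem_insert t M)) (hrefl t)

/-! ### Finite index of centralizers and of the centre -/

open scoped Pointwise in
/-- By B. H. Neumann's covering lemma all centralizers have finite index. -/
theorem NoInfiniteNonCyclicSet.finiteIndex_centralizer {G : Type*} [Group G]
    (h : NoInfiniteNonCyclicSet G) (g : G) : (Subgroup.centralizer {g}).FiniteIndex := by
  classical
  obtain ⟨M, hgM, -, hfin, hpw, hcov⟩ :=
    exists_finite_maximal_pairwise (r := fun x y : G => Commute x y) Commute.refl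
      (fun _ _ => Commute.symm)
      (fun s hs => by
        obtain ⟨x, hx, y, hy, hne, hxy⟩ := h s hs
        exact ⟨x, hx, y, hy, hne, hxy.commute⟩)
      (Set.subset_univ {g}) (Set.pairwise_singleton _ _)
  have hcovers : ⋃ m ∈ hfin.toFinset, (1 : G) • (Subgroup.centralizer {m} : Set G) = Set.univ := by
    refine Set.eq_univ_of_forall fun t => ?_
    obtain ⟨m, hm, htm⟩ := hcov t (Set.mem_univ t)
    simpa using! ⟨m, hm, Subgroup.mem_centralizer_singleton_iff.2 htm⟩
  -- The finite-index members of the cover already cover `G`, and the only member containing `g` is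
  -- its own centralizer.
  have hmem : g ∈ _ := (Subgroup.leftCoset_cover_filter_FiniteIndex hcovers).symm ▸ Set.mem_univ g
  simp only [one_smul, Set.mem_iUnion, Finset.mem_filter, Set.Finite.mem_toFinset] at hmem
  obtain ⟨m, ⟨hm, hmf⟩, hgm⟩ := hmem
  have hcomm : Commute g m := (Subgroup.mem_centralizer_singleton_iff.1 hgm)
  rcases eq_or_ne g m with rfl | hne
  · exact hmf
  · exact absurd hcomm (hpw (hgM rfl) hm hne)

/-- Pairs that fail to commute, but whose entries commute with the entries of all other pairs,
produce a sequence of pairwise non-commuting elements. -/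
theorem exists_seq_not_commute {G : Type*} [Group G] {d e : ℕ → G}
    (hde : ∀ n, ¬ Commute (d n) (e n))
    (hdd : ∀ i j, i < j → Commute (d i) (d j)) (hdj : ∀ i j, i < j → Commute (d i) (e j))
    (hed : ∀ i j, i < j → Commute (e i) (d j)) (hee : ∀ i j, i < j → Commute (e i) (e j)) :
    ∃ c : ℕ → G, ∀ i j, i < j → ¬ Commute (c i) (c j) := by
  -- With `u n = d 0 * ⋯ * d (n - 1)` take `c n = u n * e n`: for `i < j`, the only failure of
  -- commutation between the factors of `c i` and `c j` is `e i` against the factor `d i` of `u j`.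
  obtain ⟨u, hu0, hu⟩ : ∃ u : ℕ → G, u 0 = 1 ∧ ∀ n, u (n + 1) = u n * d n :=
    ⟨fun n => Nat.rec 1 (fun n a => a * d n) n, rfl, fun _ => rfl⟩
  have hcomm : ∀ (g : G) (n : ℕ), (∀ l < n, Commute g (d l)) → Commute g (u n) := by
    intro g n
    induction n with
    | zero => intro _; rw [hu0]; exact Commute.one_right g
    | succ n ih =>
      intro hg
      rw [hu]
      exact (ih fun l hl => hg l (by omega)).mul_right (hg n (by omega))
  have hdall : ∀ i j, Commute (d i) (d j) := fun i j => by
    rcases lt_trichotomy i j with hij | rfl | hij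
    · exact hdd i j hij
    · exact Commute.refl _
    · exact (hdd j i hij).symm
  have huu : ∀ i j, Commute (u i) (u j) := fun i j =>
    hcomm _ _ fun l _ => (hcomm _ _ fun k _ => hdall l k).symm
  have hue : ∀ i j, i ≤ j → Commute (u i) (e j) := fun i j hij =>
    (hcomm _ _ fun l hl => (hdj l j (by omega)).symm).symm
  have hnot : ∀ i k, ¬ Commute (e i) (u (i + 1 + k)) := by
    intro i k
    induction k with
    | zero =>
      rw [add_zero, hu]
      intro hc
      exact hde i (by simpa using ((hue i i le_rfl).symm.inv_right.mul_right hc).symm)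
    | succ k ih =>
      rw [← add_assoc, hu]
      intro hc
      exact ih (by simpa using hc.mul_right (hed i (i + 1 + k) (by omega)).inv_right)
  refine ⟨fun n => u n * e n, fun i j hij hc => ?_⟩
  have h1 : Commute (u i) (u j * e j) := (huu i j).mul_right (hue i j hij.le)
  have h2 : Commute (e i) (u j * e j) := by simpa using h1.inv_left.mul_left hc
  have h3 : Commute (e i) (u j) := by simpa using h2.mul_right (hee i j hij).inv_right
  obtain ⟨k, rfl⟩ := Nat.exists_eq_add_of_le (Nat.succ_le_of_lt hij)
  exact hnot i k h3

/-- An element of `D` that commutes with representatives of all cosets of `D` is central. -/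
theorem finiteIndex_center_of_finiteIndex_commuting {G : Type*} [Group G]
    (hfc : ∀ g : G, (Subgroup.centralizer {g}).FiniteIndex) (D : Subgroup G) [D.FiniteIndex]
    (hD : ∀ x ∈ D, ∀ y ∈ D, Commute x y) : (Subgroup.center G).FiniteIndex := by
  have : (⨅ q : G ⧸ D, Subgroup.centralizer {q.out}).FiniteIndex :=
    Subgroup.finiteIndex_iInf fun q => hfc _
  refine Subgroup.finiteIndex_of_le (H := D ⊓ ⨅ q : G ⧸ D, Subgroup.centralizer {q.out}) ?_
  rintro z ⟨hzD, hz⟩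
  refine Subgroup.mem_center_iff.2 fun g => ?_
  obtain ⟨⟨w, hw⟩, hgw⟩ := QuotientGroup.mk_out_eq_mul D g
  have h1 : Commute (g * w) z := by
    rw [← hgw]
    exact (Subgroup.mem_centralizer_singleton_iff.1 (Subgroup.mem_iInf.1 hz (g : G ⧸ D))).symm
  have h2 : Commute g z := by simpa using h1.mul_left (hD w hw z hzD).inv_left
  exact h2

theorem NoInfiniteNonCyclicSet.finiteIndex_center {G : Type*} [Group G]
    (h : NoInfiniteNonCyclicSet G) : (Subgroup.center G).FiniteIndex := by
  classical
  have hfc := h.finiteIndex_centralizer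
  by_contra hcen
  obtain ⟨f, hf, hlt⟩ := exists_seq_of_forall_finset_exists
    (fun q : G × G => ¬ Commute q.1 q.2)
    (fun q q' => (Commute q.1 q'.1 ∧ Commute q.1 q'.2) ∧ Commute q.2 q'.1 ∧ Commute q.2 q'.2)
    (fun s _ => by
      by_contra! hcon
      have : (⨅ q : s, (Subgroup.centralizer {q.1.1} ⊓ Subgroup.centralizer {q.1.2}) :
          Subgroup G).FiniteIndex := Subgroup.finiteIndex_iInf fun q => by
        have := hfc q.1.1
        have := hfc q.1.2
        infer_instance
      -- If no further pair exists, the common centralizer of the chosen entries is commutative of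
      -- finite index.
      refine hcen (finiteIndex_center_of_finiteIndex_commuting hfc
        (⨅ q : s, (Subgroup.centralizer {q.1.1} ⊓ Subgroup.centralizer {q.1.2})) ?_)
      intro x hx y hy
      by_contra hxy
      obtain ⟨q, hq, hq'⟩ := hcon (x, y) hxy
      have hqx := Subgroup.mem_iInf.1 hx ⟨q, hq⟩
      have hqy := Subgroup.mem_iInf.1 hy ⟨q, hq⟩
      simp only [Subgroup.mem_inf, Subgroup.mem_centralizer_singleton_iff] at hqx hqy
      exact hq' ⟨hqx.1.symm, hqy.1.symm⟩ hqx.2.symm hqy.2.symm)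
  obtain ⟨c, hc⟩ := exists_seq_not_commute (d := fun n => (f n).1) (e := fun n => (f n).2) hf
    (fun i j hij => (hlt i j hij).1.1) (fun i j hij => (hlt i j hij).1.2)
    (fun i j hij => (hlt i j hij).2.1) (fun i j hij => (hlt i j hij).2.2)
  obtain ⟨i, j, hij, hcyc⟩ := h.exists_lt c
  exact hc i j hij hcyc.commute

theorem mem_zpowers_of_pow_coprime {G : Type*} [Group G] {x d : G} {m n : ℕ}
    (hmn : Nat.Coprime m n) (hm : x ^ m ∈ Subgroup.zpowers d) (hn : x ^ n ∈ Subgroup.zpowers d) :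
    x ∈ Subgroup.zpowers d := by
  have hb : (1 : ℤ) = m * Nat.gcdA m n + n * Nat.gcdB m n := by
    rw [← Nat.gcd_eq_gcd_ab, hmn, Nat.cast_one]
  have : x = (x ^ m) ^ Nat.gcdA m n * (x ^ n) ^ Nat.gcdB m n := by
    rw [← zpow_natCast, ← zpow_natCast, ← zpow_mul, ← zpow_mul, ← zpow_add, ← hb, zpow_one]
  rw [this]
  exact mul_mem (Subgroup.zpow_mem _ hm _) (Subgroup.zpow_mem _ hn _)

/-! ### Groups with an element of infinite order -/

/-- With `o = orderOf t`, let `x ^ o ^ i * t` and `x ^ o ^ j * t` lie in `⟨d⟩`, `i < j`. Raising the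
first to the power `o ^ (j - i)` kills `t`, so `t ∈ ⟨d⟩`, which is infinite cyclic. -/
theorem NoInfiniteNonCyclicSet.eq_one_of_isOfFinOrder {A : Type*} [CommGroup A]
    (h : NoInfiniteNonCyclicSet A) {x t : A} (hx : ¬ IsOfFinOrder x) (ht : IsOfFinOrder t) :
    t = 1 := by
  by_contra ht1
  obtain ⟨i, j, hij, hcyc⟩ := h.exists_lt fun i => x ^ (orderOf t ^ i) * t
  obtain ⟨d, hi, hj⟩ := hcyc.exists_mem
  obtain ⟨k, rfl⟩ := Nat.exists_eq_add_of_le (Nat.succ_le_of_lt hij)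
  have hxd : x ^ (orderOf t ^ (i + 1 + k)) ∈ Subgroup.zpowers d := by
    have := pow_mem hi (orderOf t ^ (1 + k))
    rwa [mul_pow, ← pow_mul, ← pow_add, pow_add _ 1 k, pow_mul t, pow_one, pow_orderOf_eq_one,
      one_pow, mul_one, ← add_assoc] at this
  have htd : t ∈ Subgroup.zpowers d := (Subgroup.mul_mem_cancel_left _ hxd).1 hj
  have hd : ¬ IsOfFinOrder d := fun hd => by
    obtain ⟨n, hn⟩ := hxd
    have h1 : IsOfFinOrder (x ^ (orderOf t ^ (i + 1 + k))) := hn ▸ hd.zpow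
    exact hx (h1.of_pow (pow_ne_zero _ ht.orderOf_pos.ne'))
  obtain ⟨n, rfl⟩ := htd
  obtain ⟨m, hm, hm1⟩ := isOfFinOrder_iff_pow_eq_one.1 ht
  rcases eq_or_ne n 0 with rfl | hn
  · simp at ht1
  · refine hd (isOfFinOrder_iff_zpow_eq_one.2 ⟨n * m, by positivity, ?_⟩)
    rw [zpow_mul, zpow_natCast]
    exact hm1

/-- In a torsion-free abelian group two elements with a common power lie in a cyclic subgroup. -/
theorem genCyclic_of_zpow_eq_zpow {A : Type*} [CommGroup A]
    (htf : ∀ t : A, IsOfFinOrder t → t = 1) {a b : A} {m n : ℤ} (hn : n ≠ 0)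
    (hab : a ^ m = b ^ n) : GenCyclic a b := by
  obtain ⟨g, m', n', hg, hco, rfl, rfl⟩ := Int.exists_gcd_one' (m := m) (n := n)
    (Int.gcd_pos_of_ne_zero_right _ hn)
  have h1 : a ^ m' = b ^ n' := by
    refine div_eq_one.1 (htf _ (isOfFinOrder_iff_pow_eq_one.2 ⟨g, hg, ?_⟩))
    rw [div_pow, ← zpow_natCast, ← zpow_natCast, ← zpow_mul, ← zpow_mul, hab, div_self']
  obtain ⟨u, v, huv⟩ := Int.isCoprime_iff_gcd_eq_one.2 hco
  -- The generator comes from the Bézout relation `u * m' + v * n' = 1`.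
  refine genCyclic_of_mem (d := a ^ v * b ^ u) ⟨n', ?_⟩ ⟨m', ?_⟩
  · calc (a ^ v * b ^ u) ^ n' = a ^ (v * n') * (b ^ n') ^ u := by
          rw [mul_zpow, ← zpow_mul, ← zpow_mul, ← zpow_mul, mul_comm u]
      _ = a := by rw [← h1, ← zpow_mul, ← zpow_add, show v * n' + m' * u = 1 by linarith, zpow_one]
  · calc (a ^ v * b ^ u) ^ m' = (a ^ m') ^ v * b ^ (u * m') := by
          rw [mul_zpow, ← zpow_mul, ← zpow_mul, ← zpow_mul, mul_comm v]
      _ = b := by rw [h1, ← zpow_mul, ← zpow_add, show n' * v + u * m' = 1 by linarith, zpow_one]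

/-- If `a ^ i * b` and `a ^ j * b` are powers of `d`, their quotient shows that `d` and `a`, hence
`b` and `a`, have a common power. -/
theorem NoInfiniteNonCyclicSet.genCyclic_of_not_isOfFinOrder {A : Type*} [CommGroup A]
    (h : NoInfiniteNonCyclicSet A) {x : A} (hx : ¬ IsOfFinOrder x) (a b : A) : GenCyclic a b := by
  have htf : ∀ t : A, IsOfFinOrder t → t = 1 := fun t => h.eq_one_of_isOfFinOrder hx
  rcases eq_or_ne a 1 with rfl | ha
  · exact genCyclic_of_mem (Subgroup.one_mem _) (Subgroup.mem_zpowers b)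
  obtain ⟨i, j, hij, hcyc⟩ := h.exists_lt fun i => a ^ i * b
  obtain ⟨d, ⟨r, hr⟩, ⟨s, hs⟩⟩ := hcyc.exists_mem
  simp only at hr hs
  have hd : d ^ (s - r) = a ^ ((j : ℤ) - i) := by
    rw [zpow_sub, zpow_sub, hr, hs, zpow_natCast, zpow_natCast, ← div_eq_mul_inv,
      ← div_eq_mul_inv, mul_div_mul_right_eq_div]
  have hrs : s - r ≠ 0 := by
    intro h0
    rw [h0, zpow_zero] at hd
    refine ha (htf a (isOfFinOrder_iff_zpow_eq_one.2 ⟨_, ?_, hd.symm⟩))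
    omega
  have hb : b = d ^ r * a ^ (-(i : ℤ)) := by
    rw [hr, zpow_neg, zpow_natCast]; exact (by rw [mul_comm, inv_mul_cancel_left])
  refine genCyclic_of_zpow_eq_zpow htf (m := ((j : ℤ) - i) * r + -(i : ℤ) * (s - r)) hrs ?_
  rw [hb, mul_zpow, ← zpow_mul, mul_comm r, zpow_mul, hd, zpow_add, zpow_mul, zpow_mul a (-(i : ℤ))]

/-! ### Primary groups -/

/-- The subgroups of a cyclic `p`-group are the `⟨d ^ p ^ k⟩`, which form a chain. -/
theorem GenCyclic.mem_zpowers_or {A : Type*} [Group A] {p : ℕ} [hp : Fact p.Prime]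
    (hA : IsPGroup p A) {x y : A} (h : GenCyclic x y) :
    x ∈ Subgroup.zpowers y ∨ y ∈ Subgroup.zpowers x := by
  obtain ⟨d, hx, hy⟩ := h.exists_mem
  obtain ⟨n, hn⟩ := hA d
  have key : ∀ z ∈ Subgroup.zpowers d, ∃ k, z ∈ Subgroup.zpowers (d ^ p ^ k) ∧
      d ^ p ^ k ∈ Subgroup.zpowers z := by
    rintro _ ⟨i, rfl⟩
    obtain ⟨k, -, hk⟩ := (Nat.dvd_prime_pow hp.out).1
      (Int.natCast_dvd_natCast.1 (Int.gcd_dvd_right i ((p ^ n : ℕ) : ℤ)))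
    refine ⟨k, ?_, ?_⟩
    · obtain ⟨c, hc⟩ := Int.gcd_dvd_left i ((p ^ n : ℕ) : ℤ)
      refine ⟨c, ?_⟩
      simp only
      rw [← zpow_natCast, ← zpow_mul, ← hk, ← hc]
    · refine ⟨Int.gcdA i ((p ^ n : ℕ) : ℤ), ?_⟩
      have hb := Int.gcd_eq_gcd_ab i ((p ^ n : ℕ) : ℤ)
      simp only
      rw [← hk, ← zpow_natCast d, hb, zpow_add, zpow_mul d ((p ^ n : ℕ) : ℤ), zpow_natCast d (p ^ n),
        hn, one_zpow, mul_one, zpow_mul]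
  obtain ⟨k, hxk, hkx⟩ := key x hx
  obtain ⟨l, hyl, hly⟩ := key y hy
  rcases le_total k l with hkl | hkl
  · right
    obtain ⟨m, rfl⟩ := Nat.exists_eq_add_of_le hkl
    rw [pow_add, pow_mul] at hyl
    exact Subgroup.zpowers_le.2 (pow_mem hkx _) hyl
  · left
    obtain ⟨m, rfl⟩ := Nat.exists_eq_add_of_le hkl
    rw [pow_add, pow_mul] at hxk
    exact Subgroup.zpowers_le.2 (pow_mem hly _) hxk

/-- These elements lie in finitely many finite groups `⟨m⟩`: if `m = x ^ k` is not a `p`-th power,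
then `p ∤ k` and `x ∈ ⟨m⟩`. -/
theorem NoInfiniteNonCyclicSet.finite_not_pow {A : Type*} [Group A]
    (h : NoInfiniteNonCyclicSet A) {p : ℕ} [hp : Fact p.Prime] (hA : IsPGroup p A) :
    {x : A | ∀ y : A, y ^ p ≠ x}.Finite := by
  obtain ⟨M, -, hMT, hM, -, hcov⟩ := exists_finite_maximal_pairwise
    (r := fun x y : A => GenCyclic x y)
    genCyclic_self (fun _ _ => GenCyclic.symm) h
    (Set.empty_subset {x : A | ∀ y : A, y ^ p ≠ x}) (Set.pairwise_empty _)
  refine (hM.biUnion (t := fun m => (Subgroup.zpowers m : Set A)) fun m _ => ?_).subset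
    fun x hx => ?_
  · exact finite_zpowers.2 (hA.isOfFinOrder hp.out.ne_zero m)
  · obtain ⟨m, hm, hxm⟩ := hcov x hx
    refine Set.mem_biUnion hm ?_
    rcases hxm.mem_zpowers_or hA with hxm | ⟨k, hk⟩
    · exact hxm
    · obtain ⟨n, hn⟩ := hA x
      simp only at hk
      have hpk : ¬ (p : ℤ) ∣ k := by
        rintro ⟨c, rfl⟩
        refine hMT hm (x ^ c) ?_
        rw [← zpow_natCast, ← zpow_mul, mul_comm, hk]
      have hco : IsCoprime k ((p : ℤ) ^ n) :=
        (((Nat.prime_iff_prime_int.1 hp.out).coprime_iff_not_dvd.2 hpk).symm).pow_right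
      obtain ⟨u, v, huv⟩ := hco
      refine ⟨u, ?_⟩
      simp only
      rw [← hk, ← zpow_mul]
      have : x ^ (v * (p : ℤ) ^ n) = 1 := by
        rw [mul_comm, zpow_mul, ← Nat.cast_pow, zpow_natCast, hn, one_zpow]
      rw [mul_comm, ← mul_one (x ^ (u * k)), ← this, ← zpow_add, huv, zpow_one]

theorem NoInfiniteNonCyclicSet.genCyclic_of_exists_pow {A : Type*} [CommGroup A]
    (h : NoInfiniteNonCyclicSet A) {p : ℕ} (hA : IsPGroup p A)
    (hdiv : ∀ x : A, ∃ y : A, y ^ p = x) (x y : A) : GenCyclic x y := by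
  choose r hr using hdiv
  obtain ⟨u, hu0, hu⟩ : ∃ u : ℕ → A, u 0 = y ∧ ∀ n, u (n + 1) ^ p = u n :=
    ⟨fun n => Nat.rec y (fun _ a => r a) n, rfl, fun _ => hr _⟩
  have hupow : ∀ n k, u (n + k) ^ p ^ k = u n := by
    intro n k
    induction k with
    | zero => simp
    | succ k ih => rw [← add_assoc, pow_succ', pow_mul, hu, ih]
  obtain ⟨e, he⟩ := hA x
  -- Steps of length `e` in the tower of `p`-th roots `u` over `y` let a power of the later element
  -- kill `x` and leave `u (i * e)`.
  obtain ⟨i, j, hij, hcyc⟩ := h.exists_lt fun n => u (n * e) * x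
  obtain ⟨d, hi, hj⟩ := hcyc.exists_mem
  obtain ⟨k, rfl⟩ := Nat.exists_eq_add_of_le (Nat.succ_le_of_lt hij)
  have hud : u (i * e) ∈ Subgroup.zpowers d := by
    have := pow_mem hj (p ^ (e + k * e))
    have hidx : (i.succ + k) * e = i * e + (e + k * e) := by rw [Nat.succ_eq_add_one]; ring
    rwa [mul_pow, hidx, hupow, pow_add, pow_mul x, he, one_pow, mul_one] at this
  refine genCyclic_of_mem ((Subgroup.mul_mem_cancel_left _ hud).1 hi) ?_
  rw [← hu0, ← hupow 0 (i * e), zero_add]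
  exact pow_mem hud _

theorem NoInfiniteNonCyclicSet.finite_of_isPGroup {A : Type*} [CommGroup A]
    (h : NoInfiniteNonCyclicSet A) {p : ℕ} [Fact p.Prime] (hA : IsPGroup p A)
    (hnc : ∃ x y : A, ¬ GenCyclic x y) : Finite A := by
  have hT := h.finite_not_pow hA
  obtain ⟨x, hx⟩ : ∃ x : A, ∀ y : A, y ^ p ≠ x := by
    by_contra! hdiv
    obtain ⟨x, y, hxy⟩ := hnc
    exact hxy (h.genCyclic_of_exists_pow hA hdiv x y)
  -- Multiplication by the non-power `x` sends `p`-th powers into the finite set of non-powers.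
  have hR : (Set.range fun y : A => y ^ p).Finite := by
    refine Set.Finite.of_finite_image (f := fun z => x * z) (hT.subset ?_)
      (mul_right_injective x).injOn
    rintro _ ⟨_, ⟨y, rfl⟩, rfl⟩ z hz
    refine hx (z * y⁻¹) ?_
    simp only at hz
    rw [mul_pow, hz, inv_pow, mul_inv_cancel_right]
  refine Set.finite_univ_iff.1 ((hT.union hR).subset fun z _ => ?_)
  by_cases hz : ∃ y : A, y ^ p = z
  · exact Or.inr hz
  · exact Or.inl (not_exists.1 hz)

/-! ### Torsion abelian groups -/

/-- Any two elements of `p`-power order generate a cyclic subgroup. -/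
def PrimaryCyclic (A : Type*) [Group A] (p : ℕ) : Prop :=
  ∀ (x y : A) (k : ℕ), x ^ p ^ k = 1 → y ^ p ^ k = 1 → GenCyclic x y

/-- The subgroup of elements of finite order prime to `p`. -/
def primeTo (A : Type*) [CommGroup A] (p : ℕ) : Subgroup A where
  carrier := {a | ∃ n : ℕ, a ^ n = 1 ∧ Nat.Coprime n p}
  one_mem' := ⟨1, one_pow 1, Nat.coprime_one_left p⟩
  mul_mem' := by
    rintro a b ⟨m, hm, hmp⟩ ⟨n, hn, hnp⟩
    exact ⟨m * n, by rw [mul_pow, pow_mul, hm, one_pow, mul_comm m, pow_mul, hn, one_pow, one_mul],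
      hmp.mul_left hnp⟩
  inv_mem' := by
    rintro a ⟨m, hm, hmp⟩
    exact ⟨m, by rw [inv_pow, hm, inv_one], hmp⟩

theorem NoInfiniteNonCyclicSet.finite_primaryComponent {A : Type*} [CommGroup A]
    (h : NoInfiniteNonCyclicSet A) {p : ℕ} [hp : Fact p.Prime] (hnc : ¬ PrimaryCyclic A p) :
    Finite (CommGroup.primaryComponent A p) := by
  have hP : NoInfiniteNonCyclicSet (CommGroup.primaryComponent A p) := h.subgroup _
  have hpow : IsPGroup p (CommGroup.primaryComponent A p) := fun x => by
    obtain ⟨k, hk⟩ := CommGroup.mem_primaryComponent.1 x.2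
    exact ⟨k, Subtype.ext hk⟩
  simp only [PrimaryCyclic, not_forall] at hnc
  obtain ⟨x, y, k, hx, hy, hxy⟩ := hnc
  have hx' : x ∈ CommGroup.primaryComponent A p := CommGroup.mem_primaryComponent.2 ⟨k, hx⟩
  have hy' : y ∈ CommGroup.primaryComponent A p := CommGroup.mem_primaryComponent.2 ⟨k, hy⟩
  refine hP.finite_of_isPGroup hpow ⟨⟨x, hx'⟩, ⟨y, hy'⟩, fun h' => hxy ?_⟩
  obtain ⟨d, ⟨m, hm⟩, ⟨n, hn⟩⟩ := h'.exists_mem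
  exact genCyclic_of_mem (d := (d : A)) ⟨m, congrArg Subtype.val hm⟩ ⟨n, congrArg Subtype.val hn⟩

/-- By Bézout each element is a `p`-part times a part prime to `p`, so the primary component maps
onto the quotient. -/
theorem finiteIndex_primeTo {A : Type*} [CommGroup A] (htor : ∀ a : A, IsOfFinOrder a) {p : ℕ}
    [hp : Fact p.Prime] [Finite (CommGroup.primaryComponent A p)] : (primeTo A p).FiniteIndex := by
  have hsurj : Function.Surjective
      fun z : CommGroup.primaryComponent A p => ((z : A) : A ⧸ primeTo A p) := by
    intro q
    obtain ⟨a, rfl⟩ := QuotientGroup.mk_surjective q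
    obtain ⟨k, m, hpm, hkm⟩ :=
      Nat.exists_eq_pow_mul_and_not_dvd (htor a).orderOf_pos.ne' p hp.out.ne_one
    have hco : Nat.Coprime (p ^ k) m := ((Nat.Prime.coprime_iff_not_dvd hp.out).2 hpm).pow_left k
    have hb : (1 : ℤ) = (p ^ k : ℕ) * Nat.gcdA (p ^ k) m + m * Nat.gcdB (p ^ k) m := by
      rw [← Nat.gcd_eq_gcd_ab, hco, Nat.cast_one]
    have h1 : a ^ (p ^ k * m) = 1 := hkm ▸ pow_orderOf_eq_one a
    refine ⟨⟨(a ^ m) ^ Nat.gcdB (p ^ k) m, Subgroup.zpow_mem (CommGroup.primaryComponent A p)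
      ⟨k, by rw [← pow_mul, mul_comm, h1]⟩ _⟩, QuotientGroup.eq.2 ?_⟩
    have h2 : ((a ^ m) ^ Nat.gcdB (p ^ k) m)⁻¹ * a = (a ^ p ^ k) ^ Nat.gcdA (p ^ k) m := by
      rw [inv_mul_eq_iff_eq_mul, ← zpow_natCast, ← zpow_natCast, ← zpow_mul, ← zpow_mul, ← zpow_add,
        add_comm, ← hb, zpow_one]
    simp only
    rw [h2]
    refine Subgroup.zpow_mem (primeTo A p) ⟨m, by rw [← pow_mul, h1], ?_⟩ _
    exact ((Nat.Prime.coprime_iff_not_dvd hp.out).2 hpm).symm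
  have := Finite.of_surjective _ hsurj
  exact Subgroup.finiteIndex_of_finite_quotient

theorem NoInfiniteNonCyclicSet.finite_not_primaryCyclic {A : Type*} [CommGroup A]
    (h : NoInfiniteNonCyclicSet A) : {p : ℕ | p.Prime ∧ ¬ PrimaryCyclic A p}.Finite := by
  by_contra hinf
  obtain ⟨p, hpinj, hp⟩ : ∃ p : ℕ → ℕ, Function.Injective p ∧
      ∀ i, (p i).Prime ∧ ¬ PrimaryCyclic A (p i) :=
    ⟨fun i => (Set.Infinite.natEmbedding _ hinf i : ℕ),
      fun i j hij => (Set.Infinite.natEmbedding _ hinf).injective (Subtype.ext hij),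
      fun i => (Set.Infinite.natEmbedding _ hinf i).2⟩
  have hex : ∀ i, ∃ (x y : A) (k : ℕ), x ^ p i ^ k = 1 ∧ y ^ p i ^ k = 1 ∧ ¬ GenCyclic x y := by
    intro i
    have := (hp i).2
    simp only [PrimaryCyclic, not_forall] at this
    obtain ⟨x, y, k, hx, hy, hxy⟩ := this
    exact ⟨x, y, k, hx, hy, hxy⟩
  choose x y k hx hy hxy using hex
  -- The power `N` below isolates `y i ^ N` in the earlier product and `x i ^ N` in the later one,
  -- and `N` is prime to `p i`.
  obtain ⟨i, j, hij, hcyc⟩ := h.exists_lt fun n => (∏ l ∈ Finset.range n, x l) * y n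
  obtain ⟨d, hi, hj⟩ := hcyc.exists_mem
  obtain ⟨N, hN⟩ : ∃ N, N = ∏ l ∈ (Finset.range (j + 1)).erase i, p l ^ k l := ⟨_, rfl⟩
  have hco : Nat.Coprime N (p i ^ k i) := by
    rw [hN]
    refine Nat.Coprime.prod_left fun l hl => ?_
    refine Nat.Coprime.pow _ _ ((Nat.coprime_primes (hp l).1 (hp i).1).2 fun he => ?_)
    exact Finset.ne_of_mem_erase hl (hpinj he)
  have hkill : ∀ (z : A) (l : ℕ), l ≤ j → l ≠ i → z ^ p l ^ k l = 1 → z ^ N = 1 := by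
    intro z l hl hli hz
    obtain ⟨c, hc⟩ : p l ^ k l ∣ N := by
      rw [hN]
      exact Finset.dvd_prod_of_mem (fun l => p l ^ k l)
        (Finset.mem_erase.2 ⟨hli, Finset.mem_range.2 (by omega)⟩)
    rw [hc, pow_mul, hz, one_pow]
  have hyi : y i ^ N ∈ Subgroup.zpowers d := by
    have := pow_mem hi N
    rwa [mul_pow, ← Finset.prod_pow, Finset.prod_eq_one, one_mul] at this
    intro l hl
    have := Finset.mem_range.1 hl
    exact hkill _ l (by omega) (by omega) (hx l)
  have hxi : x i ^ N ∈ Subgroup.zpowers d := by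
    have := pow_mem hj N
    rwa [mul_pow, ← Finset.prod_pow, hkill _ j le_rfl hij.ne' (hy j), mul_one,
      Finset.prod_eq_single_of_mem i (Finset.mem_range.2 hij)] at this
    intro l hl hli
    exact hkill _ l (Finset.mem_range.1 hl).le hli (hx l)
  exact hxy i (genCyclic_of_mem
    (mem_zpowers_of_pow_coprime hco hxi ((hx i).symm ▸ one_mem _))
    (mem_zpowers_of_pow_coprime hco hyi ((hy i).symm ▸ one_mem _)))

/-- The clause `d ^ n = 1` serves the induction: generators of coprime exponents are both powers of
their product. -/
theorem exists_pow_eq_one_of_primary {A : Type*} [CommGroup A] {n : ℕ} (hn : n ≠ 0) {a x : A}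
    (ha : a ^ n = 1) (hx : x ^ n = 1)
    (hprim : ∀ p : ℕ, p.Prime → p ∣ n → PrimaryCyclic A p ∨ a ∈ primeTo A p) :
    ∃ d : A, d ^ n = 1 ∧ a ∈ Subgroup.zpowers d ∧ x ∈ Subgroup.zpowers d := by
  induction n using Nat.recOnPosPrimePosCoprime generalizing a x with
  | zero => exact absurd rfl hn
  | one =>
    rw [pow_one] at ha hx
    exact ⟨1, one_pow 1, by rw [ha]; exact one_mem _, by rw [hx]; exact one_mem _⟩
  | prime_pow p k hp hk =>
    rcases hprim p hp (dvd_pow_self p hk.ne') with hc | ⟨m, hm, hmp⟩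
    · obtain ⟨d, hd, had, hxd⟩ := (hc a x k ha hx).exists_mem_closure
      have hle : Subgroup.closure {a, x} ≤ (powMonoidHom (p ^ k) : A →* A).ker := by
        rw [Subgroup.closure_le]
        rintro z (rfl | rfl)
        · exact ha
        · exact hx
      exact ⟨d, hle hd, had, hxd⟩
    · have h1 : a = 1 := by
        have := mem_zpowers_of_pow_coprime (d := 1) (hmp.pow_right k) (hm ▸ one_mem _)
          (ha ▸ one_mem _)
        simpa using this
      exact ⟨x, hx, by rw [h1]; exact one_mem _, Subgroup.mem_zpowers x⟩
  | coprime m n hm1 hn1 hmn ihm ihn =>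
    obtain ⟨c, hc, hac, hxc⟩ := ihm (a := a ^ n) (x := x ^ n) (by omega)
      (by rw [← pow_mul, mul_comm, ha]) (by rw [← pow_mul, mul_comm, hx])
      fun p hp hpm => (hprim p hp (hpm.mul_right n)).imp_right fun h => pow_mem h n
    obtain ⟨d, hd, had, hxd⟩ := ihn (a := a ^ m) (x := x ^ m) (by omega)
      (by rw [← pow_mul, ha]) (by rw [← pow_mul, hx])
      fun p hp hpn => (hprim p hp (hpn.mul_left m)).imp_right fun h => pow_mem h m
    have hcd : c ∈ Subgroup.zpowers (c * d) := by
      refine mem_zpowers_of_pow_coprime hmn (hc ▸ one_mem _) ?_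
      have := pow_mem (Subgroup.mem_zpowers (c * d)) n
      rwa [mul_pow, hd, mul_one] at this
    have hdd : d ∈ Subgroup.zpowers (c * d) :=
      (Subgroup.mul_mem_cancel_left _ hcd).1 (Subgroup.mem_zpowers _)
    have hle := Subgroup.zpowers_le.2 hcd
    have hle' := Subgroup.zpowers_le.2 hdd
    exact ⟨c * d, by rw [mul_pow, pow_mul, hc, one_pow, one_mul, mul_comm m, pow_mul, hd, one_pow],
      mem_zpowers_of_pow_coprime hmn (hle' had) (hle hac),
      mem_zpowers_of_pow_coprime hmn (hle' hxd) (hle hxc)⟩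

theorem NoInfiniteNonCyclicSet.finiteIndex_Cyc_of_comm {A : Type*} [CommGroup A]
    (h : NoInfiniteNonCyclicSet A) : (Cyc A).FiniteIndex := by
  by_cases htor : ∀ a : A, IsOfFinOrder a
  · have hfin := h.finite_not_primaryCyclic.to_subtype
    have hidx : (⨅ p : {p : ℕ | p.Prime ∧ ¬ PrimaryCyclic A p}, primeTo A p).FiniteIndex :=
      Subgroup.finiteIndex_iInf fun p => by
        have : Fact (p : ℕ).Prime := ⟨p.2.1⟩
        have := h.finite_primaryComponent p.2.2
        exact finiteIndex_primeTo htor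
    refine Subgroup.finiteIndex_of_le
      (H := ⨅ p : {p : ℕ | p.Prime ∧ ¬ PrimaryCyclic A p}, primeTo A p)
      fun a ha => mem_Cyc.2 fun x => ?_
    obtain ⟨d, -, had, hxd⟩ := exists_pow_eq_one_of_primary (a := a) (x := x)
      (mul_ne_zero (htor a).orderOf_pos.ne' (htor x).orderOf_pos.ne')
      (by rw [pow_mul, pow_orderOf_eq_one, one_pow])
      (by rw [mul_comm, pow_mul, pow_orderOf_eq_one, one_pow])
      fun p hp _ => or_iff_not_imp_left.2 fun hnc => Subgroup.mem_iInf.1 ha ⟨p, hp, hnc⟩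
    exact genCyclic_of_mem hxd had
  · obtain ⟨x, hx⟩ := not_forall.1 htor
    have : Cyc A = ⊤ := eq_top_iff.2 fun a _ =>
      mem_Cyc.2 fun b => h.genCyclic_of_not_isOfFinOrder hx b a
    rw [this]
    infer_instance

theorem NoInfiniteNonCyclicSet.finiteIndex_Cyc_of_isMulCommutative {A : Type*} [hA : Group A]
    [hcomm : IsMulCommutative A] (h : NoInfiniteNonCyclicSet A) : (Cyc A).FiniteIndex := by
  let _ : CommGroup A := { hA with mul_comm := hcomm.is_comm.comm }
  exact h.finiteIndex_Cyc_of_comm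

/-! ### The general case -/

theorem exists_isMulCommutative_center_le {G : Type*} [Group G] (g : G) :
    ∃ A : Subgroup G, Subgroup.center G ≤ A ∧ g ∈ A ∧ IsMulCommutative A := by
  refine ⟨Subgroup.closure (insert g (Subgroup.center G : Set G)),
    fun z hz => Subgroup.subset_closure (Set.mem_insert_of_mem g hz),
    Subgroup.subset_closure (Set.mem_insert g _), Subgroup.isMulCommutative_closure ?_⟩
  rintro x (rfl | hx) y (rfl | hy)
  · rfl
  · exact Subgroup.mem_center_iff.1 hy x
  · exact (Subgroup.mem_center_iff.1 hx y).symm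
  · exact Subgroup.mem_center_iff.1 hy x

theorem NoInfiniteNonCyclicSet.finiteIndex_map_Cyc {G : Type*} [Group G]
    (h : NoInfiniteNonCyclicSet G) (A : Subgroup G) [IsMulCommutative A] [A.FiniteIndex] :
    ((Cyc A).map A.subtype).FiniteIndex := by
  have h1 := (h.subgroup A).finiteIndex_Cyc_of_isMulCommutative
  refine ⟨?_⟩
  rw [Subgroup.index_map_subtype]
  exact mul_ne_zero h1.index_ne_zero Subgroup.FiniteIndex.index_ne_zero

theorem iInf_map_Cyc_le {G : Type*} [Group G] {ι : Sort*} (A : ι → Subgroup G)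
    (hcov : ∀ x, ∃ i, x ∈ A i) : ⨅ i, (Cyc (A i)).map (A i).subtype ≤ Cyc G := by
  intro y hy
  rw [mem_Cyc]
  intro x
  obtain ⟨i, hi⟩ := hcov x
  have hyi := Subgroup.mem_iInf.1 hy i
  rw [Subgroup.mem_map] at hyi
  obtain ⟨z, hz, hzy⟩ := hyi
  have hxz : GenCyclic (⟨x, hi⟩ : A i) z := mem_Cyc.1 hz ⟨x, hi⟩
  have hxz' : GenCyclic x (z : G) := (genCyclic_coe (x := ⟨x, hi⟩) (y := z)).2 hxz
  rwa [← hzy]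

theorem finiteIndex_Cyc_of_forall_subgroup {G : Type*} [Group G] {ι : Type*} [Finite ι]
    (A : ι → Subgroup G) (hA : ∀ i, ((Cyc (A i)).map (A i).subtype).FiniteIndex)
    (hcov : ∀ x, ∃ i, x ∈ A i) : (Cyc G).FiniteIndex := by
  have := Subgroup.finiteIndex_iInf hA
  exact Subgroup.finiteIndex_of_le (iInf_map_Cyc_le A hcov)

theorem NoInfiniteNonCyclicSet.finiteIndex_Cyc {G : Type*} [Group G]
    (h : NoInfiniteNonCyclicSet G) : (Cyc G).FiniteIndex := by
  have hZ := h.finiteIndex_center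
  choose A hZA hgA hcomm using exists_isMulCommutative_center_le (G := G)
  -- `A q.out` contains the centre and `q.out`, hence the whole coset `q`.
  refine finiteIndex_Cyc_of_forall_subgroup (fun q : G ⧸ Subgroup.center G => A q.out)
    (fun q => ?_) fun x => ?_
  · have := hcomm q.out
    have := Subgroup.finiteIndex_of_le (hZA q.out)
    exact h.finiteIndex_map_Cyc (A q.out)
  · obtain ⟨w, hw⟩ := QuotientGroup.mk_out_eq_mul (Subgroup.center G) x
    refine ⟨x, (Subgroup.mul_mem_cancel_right _ (hZA _ w.2)).1 ?_⟩
    rw [← hw]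
    exact hgA _

/-! ### Cliques and cosets of `Cyc G` -/

theorem genCyclic_of_mk_eq {G : Type*} [Group G] {x y : G}
    (hxy : (x : G ⧸ Cyc G) = (y : G ⧸ Cyc G)) : GenCyclic x y := by
  obtain ⟨d, hx, hd⟩ := (mem_Cyc.1 (QuotientGroup.eq.1 hxy) x).exists_mem
  exact genCyclic_of_mem hx ((Subgroup.mul_mem_cancel_left _ (inv_mem hx)).1 hd)

theorem injOn_mk_of_isClique {G : Type*} [Group G] {s : Set {x : G // x ∉ Cyc G}}
    (hs : (nonCyclicGraph G).IsClique s) :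
    s.InjOn fun x : {x : G // x ∉ Cyc G} => ((x : G) : G ⧸ Cyc G) := by
  intro x hx y hy hxy
  by_contra hne
  exact hs hx hy hne (genCyclic_of_mk_eq hxy)

theorem noInfiniteNonCyclicSet_of_not_exists_isClique {G : Type*} [Group G]
    (h : ¬ ∃ s : Set {x : G // x ∉ Cyc G}, s.Infinite ∧ (nonCyclicGraph G).IsClique s) :
    NoInfiniteNonCyclicSet G := by
  intro t ht
  by_contra! hcon
  have hCyc : ∀ x ∈ t, x ∉ Cyc G := by
    intro x hx hxC
    obtain ⟨y, hy, hyx⟩ := ht.exists_notMem_finset {x}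
    exact hcon y hy x hx (by simpa using hyx) (mem_Cyc.1 hxC y)
  refine h ⟨Subtype.val ⁻¹' t, ht.preimage fun x hx => ⟨⟨x, hCyc x hx⟩, rfl⟩, ?_⟩
  intro x hx y hy hne
  exact hcon x hx y hy fun he => hne (Subtype.ext he)

theorem card_le_index_of_isNClique {G : Type*} [Group G] [Finite (G ⧸ Cyc G)] {n : ℕ}
    {s : Finset {x : G // x ∉ Cyc G}} (hs : (nonCyclicGraph G).IsNClique n s) :
    n ≤ (Cyc G).index := by
  rw [← hs.card_eq, ← Set.ncard_coe_finset, ← (injOn_mk_of_isClique hs.isClique).ncard_image,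
    Subgroup.index]
  exact Set.ncard_le_card _

end NonCyclicGraph

theorem theorem4p2 (G : Type*) [Group G] :
    ((¬ ∃ s : Set {x : G // x ∉ NonCyclicGraph.Cyc G},
        s.Infinite ∧ (NonCyclicGraph.nonCyclicGraph G).IsClique s) ↔
      Finite (G ⧸ NonCyclicGraph.Cyc G)) ∧
    (Finite (G ⧸ NonCyclicGraph.Cyc G) →
      IsGreatest {n : ℕ | ∃ s, (NonCyclicGraph.nonCyclicGraph G).IsNClique n s}
        (NonCyclicGraph.nonCyclicGraph G).cliqueNum ∧
      (NonCyclicGraph.nonCyclicGraph G).cliqueNum ≤ (NonCyclicGraph.Cyc G).index) := by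
  refine ⟨⟨fun h => ?_, ?_⟩, fun hfin => ?_⟩
  · have := (NonCyclicGraph.noInfiniteNonCyclicSet_of_not_exists_isClique h).finiteIndex_Cyc
    infer_instance
  · rintro hfin ⟨s, hs, hclique⟩
    exact hs (Set.Finite.of_finite_image (Set.toFinite _)
      (NonCyclicGraph.injOn_mk_of_isClique hclique))
  · have hbdd : (NonCyclicGraph.Cyc G).index ∈
        upperBounds {n : ℕ | ∃ s, (NonCyclicGraph.nonCyclicGraph G).IsNClique n s} := by
      rintro n ⟨s, hs⟩
      exact NonCyclicGraph.card_le_index_of_isNClique hs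
    have hmem : (NonCyclicGraph.nonCyclicGraph G).cliqueNum ∈
        {n : ℕ | ∃ s, (NonCyclicGraph.nonCyclicGraph G).IsNClique n s} :=
      -- `cliqueNum` is a supremum in `ℕ`, attained because the set is bounded and contains `0`
      -- through the empty clique.
      Nat.sSup_mem ⟨0, ∅, by simp⟩ ⟨_, hbdd⟩
    exact ⟨⟨hmem, fun n hn => le_csSup ⟨_, hbdd⟩ hn⟩, hbdd hmem⟩
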